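/- Let $m>0$ and let $|h_{r,d}|^2$ and $|h_{r,u}|^2$ be two independent random variables (the downlink and uplink Nakagami-$m$ power gains), each with the unit-mean Gamma density $\frac{m^m}{\Gamma(m)}x^{m-1}e^{-mx}$, $x>0$. Let $|h_{r,eq}|^2=|h_{r,d}|^2\,|h_{r,u}|^2$ be the equivalent radar channel gain. Then $|h_{r,eq}|^2$ has a probability density function, given for $z>0$ by $$f_{|h_{r,eq}|^2}(z)=\frac{2m^{2m}}{\Gamma(m)^2}\,z^{m-1}K_0\!\left(2m\sqrt z\right)$$ and equal to $0$ for $z\le 0$, and its cumulative distribution function is given for $z>0$ by $$F_{|h_{r,eq}|^2}(z)=\frac{1}{\Gamma(m)^2}\,G^{2,1}_{1,3}\!\left(m^2z\,\middle|\,\begin{matrix}1\\ m,m,0\end{matrix}\right)$$ and equals $0$ for $z\le 0$. Here $K_0(x)=\int_0^\infty e^{-x\cosh t}\,dt$ ($x>0$) is the modified Bessel function of the third kind (Macdonald function) of order $0$, and $G^{2,1}_{1,3}$ is the Meijer $G$-function, that is, for $w>0$, $$G^{2,1}_{1,3}\!\left(w\,\middle|\,\begin{matrix}1\\ m,m,0\end{matrix}\right)=\frac1{2\pi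 i}\int_{c-i\infty}^{c+i\infty}\frac{\Gamma(m-s)^2\,\Gamma(s)}{\Gamma(1+s)}\,w^s\,ds,\qquad 0<c<m,$$ where the line $\operatorname{Re}s=c$ separates the poles of $\Gamma(m-s)$ from those of $\Gamma(s)$. -/

import Mathlib

open MeasureTheory ProbabilityTheory

/-- The modified Bessel function of the third kind (Macdonald function, also called the modified
Bessel function of the second kind) `K_ν(x)`, for real order `ν` and real argument `x > 0`:
`K_ν(x) = ∫₀^∞ exp(-x cosh t) cosh(ν t) dt`. -/
noncomputable def besselK (ν x : ℝ) : ℝ :=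
  ∫ t in Set.Ioi (0 : ℝ), Real.exp (-x * Real.cosh t) * Real.cosh (ν * t)

/-- The Mellin-Barnes integrand of the Meijer function `G^{m,n}_{p,q}(z | a; b)`:
`∏_{j ≤ m} Γ(b_j - s) ∏_{k ≤ n} Γ(1 - a_k + s)
  / (∏_{j > m} Γ(1 - b_j + s) ∏_{k > n} Γ(a_k - s)) · z ^ s`
(the indices `j`, `k` of the mathematical formula start at `1`, those of `Fin` at `0`).
At a pole of a Gamma function of the denominator, Mathlib's conventions give the factor
`(Γ w)⁻¹` its correct value `0`. -/
noncomputable def meijerGIntegrand (m n : ℕ) {p q : ℕ} (a : Fin p → ℂ) (b : Fin q → ℂ)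
    (z s : ℂ) : ℂ :=
  (∏ j : Fin q, if (j : ℕ) < m then Complex.Gamma (b j - s)
      else (Complex.Gamma (1 - b j + s))⁻¹) *
    (∏ k : Fin p, if (k : ℕ) < n then Complex.Gamma (1 - a k + s)
      else (Complex.Gamma (a k - s))⁻¹) *
    z ^ s

/-- The upward vertical line `Re s = c` separates the poles of the Gamma functions in the numerator:
the poles `b_j + l` of `Γ(b_j - s)`, `j ≤ m`, lie to its right, and the poles `a_k - 1 - l` of
`Γ(1 - a_k + s)`, `k ≤ n`, lie to its left (`l = 0, 1, 2, …`). -/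
def MeijerGSeparates (m n : ℕ) {p q : ℕ} (a : Fin p → ℂ) (b : Fin q → ℂ) (c : ℝ) : Prop :=
  (∀ j : Fin q, (j : ℕ) < m → ∀ l : ℕ, c < (b j + l).re) ∧
    (∀ k : Fin p, (k : ℕ) < n → ∀ l : ℕ, (a k - 1 - l).re < c)

open Classical in
/-- The Meijer function `G^{m,n}_{p,q}(z | a; b)` as the Mellin-Barnes integral
`(1 / 2πi) ∫_L (integrand) ds`, for parameters whose contour `L` can be taken to be a vertical
line that separates the two families of poles (written here with `s = c + i t`, `ds = i dt`).
For `z ≠ 0` and `|arg z| < (m + n - (p + q) / 2) π` the integral converges absolutely and all such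
lines give the same value. For parameters without a separating line, which need a
curved contour, the value is the placeholder `0`. -/
noncomputable def meijerG (m n : ℕ) {p q : ℕ} (a : Fin p → ℂ) (b : Fin q → ℂ) (z : ℂ) : ℂ :=
  if h : ∃ c : ℝ, MeijerGSeparates m n a b c then
    (1 / (2 * (Real.pi : ℂ) * Complex.I)) *
      ∫ t : ℝ, meijerGIntegrand m n a b z ((h.choose : ℂ) + t * Complex.I) * Complex.I
  else 0

/-! The product law is the multiplicative convolution on `ℝ` of two copies of the Gamma law.

*Density.* The density of the product at `z` is `∫ f(x) f(z / x) dx / x`, with `f` the Gamma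
density. For `z > 0` the powers of `x` cancel and there remains a multiple of
`z ^ (m - 1) ∫₀^∞ exp (-m (x + z / x)) dx / x`; the substitution `x = √z exp t` makes the exponent
`-2 m √z cosh t` and the integral `2 K₀(2 m √z)` (`lintegral_inv_mul_exp_neg_add_div`).

*Distribution function.* Let `F` be the distribution function of the product. By Fubini
(`mellin_cdf`), for `-m < Re s < 0`, the Mellin transform of `F` at `s` is `-E[Z ^ s] / s`, and by
independence `E[Z ^ s]` is the square of the Gamma moment `m ^ (-s) Γ(m + s) / Γ(m)`. With `s`
replaced by `-s`, and `1 / s = Γ(s) / Γ(1 + s)`, this is the Mellin–Barnes integrand of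
`G^{2,1}_{1,3}`, up to the factor `Γ(m) ^ 2`. Mellin inversion then gives the formula on every line
`0 < Re s < m` (`cdf_gammaMeasure_mconv`), whichever one the definition of `meijerG` selects. It
applies because `F` is continuous (its law has a density) and because the transform is absolutely
integrable on vertical lines (`integrable_Gamma_sq_vertical`). -/

/-! ### The density of a product of independent real random variables -/

theorem lintegral_comp_mul_left_real {x : ℝ} (hx : x ≠ 0) {h : ℝ → ENNReal} (hh : Measurable h) :
    ∫⁻ y, h (x * y) = ENNReal.ofReal |x⁻¹| * ∫⁻ z, h z := by
  rw [← lintegral_map hh (measurable_const_mul x), Real.map_volume_mul_left hx,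
    lintegral_smul_measure, smul_eq_mul]

/-- The multiplicative convolution on `ℝ` of two densities with respect to Lebesgue measure. Mathlib
has the corresponding fact for Haar measures on groups, which does not cover the monoid `ℝ`. -/
theorem withDensity_mconv_withDensity_real {f g : ℝ → ENNReal} (hf : Measurable f)
    (hg : Measurable g) [SFinite (volume.withDensity g)] :
    (volume.withDensity f).mconv (volume.withDensity g) =
      volume.withDensity fun z => ∫⁻ x, f x * (ENNReal.ofReal |x⁻¹| * g (z / x)) := by
  ext A hA
  have hmeas : Measurable (A.indicator (1 : ℝ → ENNReal)) := measurable_one.indicator hA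
  rw [← lintegral_indicator_one hA, Measure.lintegral_mconv hmeas,
    lintegral_withDensity_eq_lintegral_mul _ hf, withDensity_apply _ hA]
  swap
  · exact Measurable.lintegral_prod_right' (f := fun p : ℝ × ℝ => A.indicator 1 (p.1 * p.2))
      (hmeas.comp (measurable_fst.mul measurable_snd))
  have hinner : ∀ᵐ x : ℝ, f x * ∫⁻ y, A.indicator 1 (x * y) ∂(volume.withDensity g) =
      ∫⁻ z in A, f x * (ENNReal.ofReal |x⁻¹| * g (z / x)) := by
    filter_upwards [compl_mem_ae_iff.2 (measure_singleton (0 : ℝ))] with x hx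
    have hx0 : x ≠ 0 := hx
    have hgx : Measurable fun z : ℝ => g (z / x) := hg.comp (measurable_id.div_const x)
    have hprod : Measurable fun z : ℝ => g (z / x) * A.indicator 1 z := hgx.mul hmeas
    have hcomp : Measurable fun y : ℝ => A.indicator (1 : ℝ → ENNReal) (x * y) :=
      hmeas.comp (measurable_const_mul x)
    rw [lintegral_withDensity_eq_lintegral_mul _ hg hcomp,
      lintegral_const_mul _ (hgx.const_mul _), lintegral_const_mul _ hgx,
      ← lintegral_indicator hA]
    congr 1
    calc ∫⁻ y, g y * A.indicator 1 (x * y)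
        = ∫⁻ y, (fun z => g (z / x) * A.indicator 1 z) (x * y) := by
          refine lintegral_congr fun y => ?_
          simp [mul_div_cancel_left₀ _ hx0]
      _ = _ := by
          rw [lintegral_comp_mul_left_real hx0 hprod]
          refine congrArg _ (lintegral_congr fun z => ?_)
          by_cases hz : z ∈ A <;> simp [hz]
  refine (lintegral_congr_ae hinner).trans (lintegral_lintegral_swap ?_)
  exact Measurable.aemeasurable (by unfold Function.uncurry; fun_prop)

/-! ### The Macdonald function as an integral over the real line -/

theorem integrable_exp_neg_mul_cosh {a : ℝ} (ha : 0 < a) :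
    Integrable fun t : ℝ => Real.exp (-a * Real.cosh t) := by
  refine (integrable_exp_neg_mul_sq (b := a / 4) (by positivity)).mono'
    (by fun_prop) (.of_forall fun t => ?_)
  rw [Real.norm_of_nonneg (Real.exp_nonneg _), Real.exp_le_exp]
  have h1 : t ^ 2 / 4 ≤ Real.cosh t := by
    rw [← Real.cosh_abs, Real.cosh_eq, ← sq_abs]
    have h2 := Real.quadratic_le_exp_of_nonneg (abs_nonneg t)
    have h3 := Real.exp_pos (-|t|)
    have h4 := abs_nonneg t
    linarith
  nlinarith

theorem integral_exp_neg_mul_cosh (a : ℝ) :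
    ∫ t : ℝ, Real.exp (-a * Real.cosh t) = 2 * besselK 0 a := by
  have h := integral_comp_abs (f := fun t => Real.exp (-a * Real.cosh t))
  simpa [besselK, Real.cosh_abs] using h

/-- The classical integral `∫₀^∞ exp (-m (x + z / x)) dx / x = 2 K₀(2 m √z)`, obtained from the
substitution `x = √z exp t`. -/
theorem lintegral_inv_mul_exp_neg_add_div {m z : ℝ} (hm : 0 < m) (hz : 0 < z) :
    ∫⁻ x in Set.Ioi (0 : ℝ), ENNReal.ofReal (x⁻¹ * Real.exp (-m * (x + z / x))) =
      ENNReal.ofReal (2 * besselK 0 (2 * m * √z)) := by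
  have hs : 0 < √z := Real.sqrt_pos.2 hz
  have himage : (fun t : ℝ => √z * Real.exp t) '' Set.univ = Set.Ioi 0 := by
    ext x
    simp only [Set.image_univ, Set.mem_range, Set.mem_Ioi]
    refine ⟨?_, fun hx => ⟨Real.log (x / √z), ?_⟩⟩
    · rintro ⟨t, rfl⟩
      positivity
    · rw [Real.exp_log (by positivity)]
      field_simp
  rw [← himage, lintegral_image_eq_lintegral_abs_deriv_mul MeasurableSet.univ
    (f' := fun t => √z * Real.exp t)
    (fun t _ => ((Real.hasDerivAt_exp t).const_mul _).hasDerivWithinAt)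
    (fun a _ b _ hab => Real.exp_injective (mul_left_cancel₀ hs.ne' hab)),
    Measure.restrict_univ, ← integral_exp_neg_mul_cosh,
    ofReal_integral_eq_lintegral_ofReal (integrable_exp_neg_mul_cosh (by positivity))
      (.of_forall fun _ => Real.exp_nonneg _)]
  refine lintegral_congr fun t => ?_
  rw [← ENNReal.ofReal_mul (abs_nonneg _), abs_of_pos (by positivity), ← mul_assoc,
    mul_inv_cancel₀ (by positivity), one_mul]
  congr 2
  have hzz : z / (√z * Real.exp t) = √z * Real.exp (-t) := by
    rw [Real.exp_neg, div_eq_iff (by positivity)]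
    field_simp
    rw [Real.sq_sqrt hz.le]
  rw [hzz, Real.cosh_eq]
  ring

/-! ### The density of a product of two Gamma variables -/

@[fun_prop]
theorem measurable_gammaPDF (a r : ℝ) : Measurable (gammaPDF a r) :=
  (measurable_gammaPDFReal a r).ennreal_ofReal

theorem lintegral_gammaPDF_mul_gammaPDF {m z : ℝ} (hm : 0 < m) (hz : z ≠ 0) :
    ∫⁻ x, gammaPDF m m x * (ENNReal.ofReal |x⁻¹| * gammaPDF m m (z / x)) =
      ENNReal.ofReal (if 0 < z then
        2 * m ^ (2 * m) / Real.Gamma m ^ 2 * z ^ (m - 1) * besselK 0 (2 * m * √z) else 0) := by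
  have hsupp : ∀ x ∉ Set.Ioi (0 : ℝ),
      gammaPDF m m x * (ENNReal.ofReal |x⁻¹| * gammaPDF m m (z / x)) = 0 := by
    intro x hx
    rcases (not_lt.1 hx : x ≤ 0).lt_or_eq with h | h
    · simp [gammaPDF_of_neg h]
    · simp [h]
  rw [← setLIntegral_eq_of_support_subset (s := Set.Ioi (0 : ℝ))
    (fun x hx => by_contra fun h => hx (hsupp x h))]
  rcases hz.lt_or_gt with hz | hz
  · rw [if_neg hz.not_gt, ENNReal.ofReal_zero, setLIntegral_congr_fun (g := fun _ => 0)
      measurableSet_Ioi fun x (hx : 0 < x) => ?_, lintegral_zero]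
    simp [gammaPDF_of_neg (div_neg_of_neg_of_pos hz hx)]
  · have hC : 0 ≤ m ^ (2 * m) / Real.Gamma m ^ 2 * z ^ (m - 1) := by positivity
    rw [if_pos hz, setLIntegral_congr_fun (g := fun x =>
      ENNReal.ofReal (m ^ (2 * m) / Real.Gamma m ^ 2 * z ^ (m - 1)) *
        ENNReal.ofReal (x⁻¹ * Real.exp (-m * (x + z / x)))) measurableSet_Ioi
        fun x (hx : 0 < x) => ?_, lintegral_const_mul _ (by fun_prop),
      lintegral_inv_mul_exp_neg_add_div hm hz, ← ENNReal.ofReal_mul hC]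
    · congr 1
      ring
    · have hΓ := (Real.Gamma_pos_of_pos hm).ne'
      have hxz : z ^ (m - 1) = x ^ (m - 1) * (z / x) ^ (m - 1) := by
        rw [← Real.mul_rpow hx.le (by positivity), mul_div_cancel₀ _ hx.ne']
      simp only
      rw [gammaPDF_of_nonneg hx.le, gammaPDF_of_nonneg (by positivity),
        ← ENNReal.ofReal_mul (abs_nonneg _), ← ENNReal.ofReal_mul (by positivity),
        ← ENNReal.ofReal_mul hC, abs_of_pos (inv_pos.2 hx), hxz, two_mul m,
        Real.rpow_add hm, mul_add, Real.exp_add, neg_mul, neg_mul]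
      congr 1
      ring

/-- The law of a product of two independent `Gamma (m, m)` variables has a density expressed by
`K₀`. -/
theorem gammaMeasure_mconv_gammaMeasure {m : ℝ} (hm : 0 < m) :
    ∃ f : ℝ → ENNReal, Measurable f ∧
      (f =ᵐ[volume] fun z : ℝ => ENNReal.ofReal (if 0 < z then
        2 * m ^ (2 * m) / Real.Gamma m ^ 2 * z ^ (m - 1) * besselK 0 (2 * m * √z) else 0)) ∧
      (gammaMeasure m m).mconv (gammaMeasure m m) = volume.withDensity f := by
  have := isProbabilityMeasure_gammaMeasure hm hm
  have : SFinite (volume.withDensity (gammaPDF m m)) := inferInstanceAs (SFinite (gammaMeasure m m))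
  refine ⟨_, ?_, ?_, withDensity_mconv_withDensity_real (measurable_gammaPDF m m)
    (measurable_gammaPDF m m)⟩
  · exact Measurable.lintegral_prod_right'
      (f := fun p : ℝ × ℝ => gammaPDF m m p.2 * (ENNReal.ofReal |p.2⁻¹| * gammaPDF m m (p.1 / p.2)))
      (by fun_prop)
  · filter_upwards [compl_mem_ae_iff.2 (measure_singleton (0 : ℝ))] with z hz
    exact lintegral_gammaPDF_mul_gammaPDF hm hz

/-! ### Complex moments of the Gamma distribution -/

theorem gammaMeasure_ae_pos (a r : ℝ) : ∀ᵐ x ∂gammaMeasure a r, 0 < x := by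
  have h0 : ∀ᵐ x : ℝ ∂gammaMeasure a r, x ≠ 0 :=
    (withDensity_absolutelyContinuous _ _).ae_le (compl_mem_ae_iff.2 (measure_singleton (0 : ℝ)))
  have h1 : ∀ᵐ x ∂gammaMeasure a r, 0 ≤ x := by
    rw [gammaMeasure, ae_withDensity_iff (measurable_gammaPDF a r)]
    exact .of_forall fun x hx => not_lt.1 fun h => hx (gammaPDF_of_neg h)
  filter_upwards [h0, h1] with x hx hx' using lt_of_le_of_ne hx' hx.symm

theorem integral_cpow_gammaMeasure {a r : ℝ} (ha : 0 < a) (hr : 0 < r) {s : ℂ}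
    (hs : 0 < a + s.re) :
    ∫ x : ℝ, (x : ℂ) ^ s ∂gammaMeasure a r =
      (r : ℂ) ^ (-s) * Complex.Gamma (a + s) / Complex.Gamma a := by
  have hrC : (r : ℂ) ≠ 0 := Complex.ofReal_ne_zero.2 hr.ne'
  rw [gammaMeasure, integral_withDensity_eq_integral_toReal_smul
    (measurable_gammaPDF a r) (.of_forall fun _ => ENNReal.ofReal_lt_top)]
  have hsupp : ∀ x ∉ Set.Ici (0 : ℝ), (gammaPDF a r x).toReal • (x : ℂ) ^ s = 0 := by
    intro x hx
    simp [gammaPDF_of_neg (not_le.1 hx)]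
  rw [← setIntegral_eq_integral_of_forall_compl_eq_zero hsupp, integral_Ici_eq_integral_Ioi,
    setIntegral_congr_fun (g := fun x : ℝ => ((r : ℂ) ^ (a : ℂ) / Complex.Gamma a) *
      ((x : ℂ) ^ ((a + s) - 1) * Complex.exp (-(r * x)))) measurableSet_Ioi
      fun x (hx : 0 < x) => ?_, integral_const_mul,
    Complex.integral_cpow_mul_exp_neg_mul_Ioi (by simpa using hs) hr, one_div,
    Complex.inv_cpow _ _ (by rw [Complex.arg_ofReal_of_nonneg hr.le]; exact Real.pi_pos.ne),
    Complex.cpow_add _ _ hrC, Complex.cpow_neg]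
  · have := (Complex.cpow_ne_zero_iff (x := r) (y := a)).2 (.inl hrC)
    field_simp
  · have hxC : (x : ℂ) ≠ 0 := Complex.ofReal_ne_zero.2 hx.ne'
    have hpos : 0 ≤ r ^ a / Real.Gamma a * x ^ (a - 1) * Real.exp (-(r * x)) := by positivity
    simp only
    rw [gammaPDF_of_nonneg hx.le, ENNReal.toReal_ofReal hpos, Complex.real_smul,
      show ((a : ℂ) + s) - 1 = (a - 1) + s by ring, Complex.cpow_add _ _ hxC]
    push_cast [Complex.ofReal_cpow hr.le, Complex.ofReal_cpow hx.le, Complex.Gamma_ofReal]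
    ring

theorem integrable_cpow_gammaMeasure {a r : ℝ} (ha : 0 < a) (hr : 0 < r) {s : ℂ}
    (hs : 0 < a + s.re) : Integrable (fun x : ℝ => (x : ℂ) ^ s) (gammaMeasure a r) := by
  -- A non-integrable function would have integral `0`, but the value found above is not `0`.
  refine .of_integral_ne_zero ?_
  rw [integral_cpow_gammaMeasure ha hr hs]
  refine div_ne_zero (mul_ne_zero ?_ (Complex.Gamma_ne_zero_of_re_pos (by simpa using hs)))
    (Complex.Gamma_ne_zero_of_re_pos (by simpa using ha))
  exact Complex.cpow_ne_zero_iff.2 (.inl (Complex.ofReal_ne_zero.2 hr.ne'))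

/-! ### Complex moments of a product of independent positive variables -/

section Mconv

variable {μ ν : Measure ℝ}

theorem mconv_ae_pos (hμ : ∀ᵐ x ∂μ, 0 < x) (hν : ∀ᵐ x ∂ν, 0 < x) :
    ∀ᵐ z ∂μ.mconv ν, 0 < z := by
  have hmul : Measurable fun p : ℝ × ℝ => p.1 * p.2 := by fun_prop
  refine (ae_map_iff hmul.aemeasurable measurableSet_Ioi).2 ?_
  filter_upwards [Measure.quasiMeasurePreserving_fst.ae hμ,
    Measure.quasiMeasurePreserving_snd.ae hν] with p h1 h2 using mul_pos h1 h2

theorem cpow_mul_ae_eq (hμ : ∀ᵐ x ∂μ, 0 < x) (hν : ∀ᵐ x ∂ν, 0 < x) (s : ℂ) :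
    (fun p : ℝ × ℝ => ((p.1 * p.2 : ℝ) : ℂ) ^ s) =ᵐ[μ.prod ν]
      fun p => (p.1 : ℂ) ^ s * (p.2 : ℂ) ^ s := by
  filter_upwards [Measure.quasiMeasurePreserving_fst.ae hμ,
    Measure.quasiMeasurePreserving_snd.ae hν] with p h1 h2
  rw [Complex.ofReal_mul, Complex.mul_cpow_ofReal_nonneg h1.le h2.le]

theorem integrable_cpow_mconv [SFinite ν] (hμ : ∀ᵐ x ∂μ, 0 < x) (hν : ∀ᵐ x ∂ν, 0 < x) {s : ℂ}
    (hiμ : Integrable (fun x : ℝ => (x : ℂ) ^ s) μ)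
    (hiν : Integrable (fun x : ℝ => (x : ℂ) ^ s) ν) :
    Integrable (fun z : ℝ => (z : ℂ) ^ s) (μ.mconv ν) := by
  have hmeas : Measurable fun z : ℝ => (z : ℂ) ^ s := by fun_prop
  refine (integrable_map_measure hmeas.aestronglyMeasurable (by fun_prop)).2 ?_
  exact (hiμ.mul_prod hiν).congr (cpow_mul_ae_eq hμ hν s).symm

theorem integral_cpow_mconv [SFinite μ] [SFinite ν] (hμ : ∀ᵐ x ∂μ, 0 < x) (hν : ∀ᵐ x ∂ν, 0 < x)
    (s : ℂ) :
    ∫ z : ℝ, (z : ℂ) ^ s ∂μ.mconv ν = (∫ x : ℝ, (x : ℂ) ^ s ∂μ) * ∫ y : ℝ, (y : ℂ) ^ s ∂ν := by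
  have hmeas : Measurable fun z : ℝ => (z : ℂ) ^ s := by fun_prop
  rw [Measure.mconv, integral_map (by fun_prop) hmeas.aestronglyMeasurable,
    integral_congr_ae (cpow_mul_ae_eq hμ hν s)]
  exact integral_prod_mul (fun x : ℝ => (x : ℂ) ^ s) fun y : ℝ => (y : ℂ) ^ s

end Mconv

/-! ### The Mellin transform of a distribution function -/

section MellinCDF

variable {μ : Measure ℝ} [IsProbabilityMeasure μ]

theorem ofReal_cdf_eq_integral (z : ℝ) :
    (cdf μ z : ℂ) = ∫ w, (Set.Iic z).indicator (fun _ => (1 : ℂ)) w ∂μ := by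
  rw [integral_indicator_const _ measurableSet_Iic, cdf_eq_real]
  simp

theorem cpow_mul_indicator_eq (s : ℂ) (w : ℝ) :
    (fun z : ℝ => (z : ℂ) ^ s * (Set.Iic z).indicator (fun _ => 1) w) =
      (Set.Ici w).indicator fun z : ℝ => (z : ℂ) ^ s := by
  ext z
  by_cases h : w ≤ z <;> simp [h]

/-- The kernel `z ^ (s - 1) 1_{w ≤ z}` is integrable in `(z, w)` when the law of `w` has a finite
moment of order `s`, `Re s < 0`. -/
theorem integrable_cpow_mul_indicator (hμ : ∀ᵐ x ∂μ, 0 < x) {s : ℂ} (hs : s.re < 0)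
    (hi : Integrable (fun x : ℝ => (x : ℂ) ^ s) μ) :
    Integrable (fun p : ℝ × ℝ => (p.1 : ℂ) ^ (s - 1) * (Set.Iic p.1).indicator (fun _ => 1) p.2)
      ((volume.restrict (Set.Ioi 0)).prod μ) := by
  have hmeas : Measurable fun p : ℝ × ℝ =>
      (p.1 : ℂ) ^ (s - 1) * (Set.Iic p.1).indicator (fun _ => 1) p.2 := by
    have h : Measurable ({p : ℝ × ℝ | p.2 ≤ p.1}.indicator fun _ => (1 : ℂ)) :=
      measurable_const.indicator (measurableSet_le measurable_snd measurable_fst)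
    exact Measurable.mul (by fun_prop) h
  have hre : (s - 1).re < -1 := by rw [Complex.sub_re, Complex.one_re]; linarith
  rw [integrable_prod_iff' hmeas.aestronglyMeasurable]
  constructor
  · filter_upwards [hμ] with w hw
    rw [cpow_mul_indicator_eq]
    refine ((integrableOn_Ici_iff_integrableOn_Ioi).2
      (integrableOn_Ioi_cpow_of_lt hre hw)).integrable_indicator measurableSet_Ici |>.restrict
  · refine (hi.norm.mul_const (-s.re)⁻¹).congr ?_
    filter_upwards [hμ] with w hw
    have hnorm : ∀ z : ℝ, ‖(z : ℂ) ^ (s - 1) * (Set.Iic z).indicator (fun _ => 1) w‖ =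
        (Set.Ici w).indicator (fun z => ‖(z : ℂ) ^ (s - 1)‖) z := by
      intro z
      by_cases h : w ≤ z <;> simp [h]
    simp_rw [hnorm]
    rw [setIntegral_indicator measurableSet_Ici, Set.inter_eq_self_of_subset_right
      (Set.Ici_subset_Ioi.2 hw), integral_Ici_eq_integral_Ioi,
      setIntegral_congr_fun (g := fun z : ℝ => z ^ (s.re - 1)) measurableSet_Ioi
        (fun z hz => by
          simpa using Complex.norm_cpow_eq_rpow_re_of_pos (hw.trans hz) (s - 1)),
      integral_Ioi_rpow_of_lt (by linarith) hw, Complex.norm_cpow_eq_rpow_re_of_pos hw,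
      sub_add_cancel]
    rw [neg_div, ← div_neg, div_eq_mul_inv]

theorem cpow_smul_cdf_eq_integral (s : ℂ) (z : ℝ) :
    (z : ℂ) ^ (s - 1) • (cdf μ z : ℂ) =
      ∫ w, (z : ℂ) ^ (s - 1) * (Set.Iic z).indicator (fun _ => 1) w ∂μ := by
  rw [integral_const_mul, ofReal_cdf_eq_integral, smul_eq_mul]

theorem mellinConvergent_cdf (hμ : ∀ᵐ x ∂μ, 0 < x) {s : ℂ} (hs : s.re < 0)
    (hi : Integrable (fun x : ℝ => (x : ℂ) ^ s) μ) :
    MellinConvergent (fun z => (cdf μ z : ℂ)) s := by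
  have h := (integrable_cpow_mul_indicator hμ hs hi).integral_prod_left
  simpa only [MellinConvergent, IntegrableOn, cpow_smul_cdf_eq_integral] using h

/-- The Mellin transform of a distribution function in the left half-plane, by Fubini. -/
theorem mellin_cdf (hμ : ∀ᵐ x ∂μ, 0 < x) {s : ℂ} (hs : s.re < 0)
    (hi : Integrable (fun x : ℝ => (x : ℂ) ^ s) μ) :
    mellin (fun z => (cdf μ z : ℂ)) s = -(∫ x : ℝ, (x : ℂ) ^ s ∂μ) / s := by
  simp_rw [mellin, cpow_smul_cdf_eq_integral]
  rw [integral_integral_swap (integrable_cpow_mul_indicator hμ hs hi), ← integral_neg,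
    ← integral_div]
  refine integral_congr_ae ?_
  filter_upwards [hμ] with w hw
  have hre : (s - 1).re < -1 := by rw [Complex.sub_re, Complex.one_re]; linarith
  rw [cpow_mul_indicator_eq, setIntegral_indicator measurableSet_Ici,
    Set.inter_eq_self_of_subset_right (Set.Ici_subset_Ioi.2 hw), integral_Ici_eq_integral_Ioi,
    integral_Ioi_cpow_of_lt hre hw, sub_add_cancel]

theorem continuous_cdf [NullSingletonClass μ] : Continuous (cdf μ) := by
  refine continuous_iff_continuousAt.2 fun z => ?_
  rw [(cdf μ).mono.continuousAt_iff_leftLim_eq_rightLim, StieltjesFunction.rightLim_eq]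
  have h := (cdf μ).measure_singleton z
  rw [measure_cdf, measure_singleton, eq_comm, ENNReal.ofReal_eq_zero, sub_nonpos] at h
  exact le_antisymm ((cdf μ).mono.leftLim_le le_rfl) h

end MellinCDF

/-! ### Decay of the Gamma function on vertical lines -/

theorem norm_Gamma_le_Gamma_re {s : ℂ} (hs : 0 < s.re) : ‖Complex.Gamma s‖ ≤ Real.Gamma s.re := by
  rw [Complex.Gamma_eq_integral hs, Real.Gamma_eq_integral hs, Complex.GammaIntegral]
  refine (norm_integral_le_integral_norm _).trans_eq
    (setIntegral_congr_fun measurableSet_Ioi fun x (hx : 0 < x) => ?_)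
  rw [norm_mul, Complex.norm_cpow_eq_rpow_re_of_pos hx, Complex.norm_of_nonneg (Real.exp_nonneg _)]
  simp

/-- One step of the functional equation gains a factor `1 / |s|`, so the square of the Gamma
function decays like `1 / t ^ 2`, which is enough for absolute convergence. -/
theorem integrable_Gamma_sq_vertical {a : ℝ} (ha : 0 < a) :
    Integrable fun t : ℝ => Complex.Gamma (a + t * Complex.I) ^ 2 := by
  have hcont : Continuous fun t : ℝ => Complex.Gamma (a + t * Complex.I) := by
    refine continuous_iff_continuousAt.2 fun t => ?_
    refine ContinuousAt.comp (g := Complex.Gamma) ?_ (by fun_prop)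
    refine (Complex.differentiableAt_Gamma _ fun n h => ?_).continuousAt
    have h' := congrArg Complex.re h
    simp at h'
    linarith [n.cast_nonneg (α := ℝ)]
  refine (integrable_inv_one_add_sq.const_mul (Real.Gamma (a + 1) ^ 2 * (1 + (a ^ 2)⁻¹))).mono'
    (hcont.pow 2).aestronglyMeasurable (.of_forall fun t => ?_)
  have hne : (a + t * Complex.I : ℂ) ≠ 0 := fun h => by
    have h' := congrArg Complex.re h
    simp at h'
    exact ha.ne' h'
  have hsq : ‖(a + t * Complex.I : ℂ)‖ ^ 2 = a ^ 2 + t ^ 2 := by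
    rw [Complex.sq_norm, Complex.normSq_add_mul_I]
  have hΓ : ‖Complex.Gamma (a + t * Complex.I + 1)‖ ≤ Real.Gamma (a + 1) := by
    simpa using norm_Gamma_le_Gamma_re (s := a + t * Complex.I + 1) (by simp; linarith)
  rw [Complex.Gamma_add_one _ hne, norm_mul] at hΓ
  have hΓ2 := pow_le_pow_left₀ (by positivity) hΓ 2
  rw [mul_pow, hsq] at hΓ2
  rw [norm_pow, mul_assoc, ← div_eq_mul_inv]
  calc ‖Complex.Gamma (a + t * Complex.I)‖ ^ 2
      ≤ Real.Gamma (a + 1) ^ 2 * (a ^ 2 + t ^ 2)⁻¹ := by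
        rw [← div_eq_mul_inv, le_div_iff₀ (by positivity)]
        linarith
    _ ≤ _ := by
        gcongr
        rw [inv_eq_one_div, div_le_div_iff₀ (by positivity) (by positivity)]
        have : (1 + (a ^ 2)⁻¹) * (a ^ 2 + t ^ 2) = 1 + t ^ 2 + a ^ 2 + (a ^ 2)⁻¹ * t ^ 2 := by
          field_simp
          ring
        rw [this]
        nlinarith [show 0 ≤ (a ^ 2)⁻¹ * t ^ 2 by positivity, sq_nonneg a]

/-! ### The distribution function as a Mellin–Barnes integral -/

section GammaProduct

variable {m : ℝ}

theorem mellin_cdf_gammaMeasure_mconv (hm : 0 < m) {s : ℂ} (hs : s.re < 0) (hms : 0 < m + s.re)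
    [IsProbabilityMeasure ((gammaMeasure m m).mconv (gammaMeasure m m))] :
    MellinConvergent (fun z => (cdf ((gammaMeasure m m).mconv (gammaMeasure m m)) z : ℂ)) s ∧
      mellin (fun z => (cdf ((gammaMeasure m m).mconv (gammaMeasure m m)) z : ℂ)) s =
        -((m : ℂ) ^ (-s) * Complex.Gamma (m + s) / Complex.Gamma m) ^ 2 / s := by
  have := isProbabilityMeasure_gammaMeasure hm hm
  have hpos := gammaMeasure_ae_pos m m
  have hi := integrable_cpow_gammaMeasure hm hm hms
  have hi' := integrable_cpow_mconv hpos hpos hi hi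
  refine ⟨mellinConvergent_cdf (mconv_ae_pos hpos hpos) hs hi', ?_⟩
  rw [mellin_cdf (mconv_ae_pos hpos hpos) hs hi', integral_cpow_mconv hpos hpos,
    integral_cpow_gammaMeasure hm hm hms, sq]

/-- The Mellin transform of the distribution function is absolutely integrable on vertical lines
`Re s = σ` with `-m < σ < 0`. -/
theorem verticalIntegrable_mellin_cdf (hm : 0 < m) {σ : ℝ} (hσ : σ < 0) (hmσ : 0 < m + σ)
    [IsProbabilityMeasure ((gammaMeasure m m).mconv (gammaMeasure m m))] :
    Complex.VerticalIntegrable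
      (mellin fun z => (cdf ((gammaMeasure m m).mconv (gammaMeasure m m)) z : ℂ)) σ := by
  have hmC : (m : ℂ) ≠ 0 := Complex.ofReal_ne_zero.2 hm.ne'
  have hne (t : ℝ) : (σ + t * Complex.I : ℂ) ≠ 0 := fun h => by
    have h' := congrArg Complex.re h
    simp at h'
    exact hσ.ne h'
  have hcont : Continuous fun t : ℝ =>
      -((m : ℂ) ^ (-(σ + t * Complex.I)) / Complex.Gamma m) ^ 2 / (σ + t * Complex.I) := by
    refine Continuous.div (.neg (.pow (.div_const ?_ _) 2)) (by fun_prop) hne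
    exact Continuous.const_cpow (by fun_prop) (.inl hmC)
  refine ((integrable_Gamma_sq_vertical hmσ).bdd_mul (c := (m ^ (-σ) / Real.Gamma m) ^ 2 / |σ|)
    hcont.aestronglyMeasurable (.of_forall fun t => ?_)).congr (.of_forall fun t => ?_)
  · rw [norm_div, norm_neg, norm_pow, norm_div, Complex.norm_cpow_eq_rpow_re_of_pos hm,
      Complex.Gamma_ofReal, Complex.norm_of_nonneg (Real.Gamma_pos_of_pos hm).le]
    have hσt : |σ| ≤ ‖(σ + t * Complex.I : ℂ)‖ := by
      simpa using Complex.abs_re_le_norm (σ + t * Complex.I)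
    have : 0 < |σ| := abs_pos.2 hσ.ne
    simp only [Complex.neg_re, Complex.add_re, Complex.ofReal_re, Complex.mul_re, Complex.I_re,
      mul_zero, Complex.ofReal_im, Complex.I_im, zero_mul, sub_self, add_zero]
    gcongr
  · simp only
    rw [(mellin_cdf_gammaMeasure_mconv hm (by simpa using hσ) (by simpa using hmσ)).2]
    push_cast
    ring_nf

theorem meijerGIntegrand_two_one (m : ℝ) (w s : ℂ) :
    meijerGIntegrand 2 1 ![(1 : ℂ)] ![(m : ℂ), (m : ℂ), 0] w s =
      Complex.Gamma (m - s) ^ 2 * (Complex.Gamma (1 + s))⁻¹ * Complex.Gamma s * w ^ s := by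
  simp [meijerGIntegrand, Fin.prod_univ_three, sq]

/-- For `G^{2,1}_{1,3}(w | 1; m, m, 0)` the separating vertical lines are those with
`0 < Re s < m`. -/
theorem meijerGSeparates_two_one_iff (m c : ℝ) :
    MeijerGSeparates 2 1 ![(1 : ℂ)] ![(m : ℂ), (m : ℂ), 0] c ↔ 0 < c ∧ c < m := by
  simp only [MeijerGSeparates, Fin.forall_fin_succ]
  simp
  constructor
  · rintro ⟨h1, h2⟩
    exact ⟨by simpa using h2 0, by simpa using h1 0⟩
  · rintro ⟨h1, h2⟩
    exact ⟨fun l => by linarith [l.cast_nonneg (α := ℝ)],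
      fun l => by linarith [l.cast_nonneg (α := ℝ)]⟩

/-- Mellin inversion along any separating line. -/
theorem cdf_gammaMeasure_mconv (hm : 0 < m) {c : ℝ} (hc : 0 < c) (hcm : c < m) {z : ℝ} (hz : 0 < z)
    [IsProbabilityMeasure ((gammaMeasure m m).mconv (gammaMeasure m m))]
    [NullSingletonClass ((gammaMeasure m m).mconv (gammaMeasure m m))] :
    (cdf ((gammaMeasure m m).mconv (gammaMeasure m m)) z : ℂ) =
      (1 / (2 * (Real.pi : ℂ) * Complex.I)) * (∫ t : ℝ, meijerGIntegrand 2 1 ![(1 : ℂ)]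
        ![(m : ℂ), (m : ℂ), 0] ((m ^ 2 * z : ℝ) : ℂ) (c + t * Complex.I) * Complex.I) /
        ((Real.Gamma m ^ 2 : ℝ) : ℂ) := by
  have hσ : -c < 0 := neg_lt_zero.2 hc
  have hmσ : 0 < m + -c := by linarith
  have hΓ : (Complex.Gamma m) ≠ 0 := Complex.Gamma_ne_zero_of_re_pos (by simpa using hm)
  rw [← mellinInv_mellin_eq (-c) (fun z =>
      (cdf ((gammaMeasure m m).mconv (gammaMeasure m m)) z : ℂ)) hz
    (mellin_cdf_gammaMeasure_mconv hm (by simpa using hσ) (by simpa using hmσ)).1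
    (verticalIntegrable_mellin_cdf hm hσ hmσ)
    (Complex.continuous_ofReal.comp continuous_cdf).continuousAt,
    -- Mellin inversion runs over `Re s = -c`; reflecting `t` turns this into `Re s = c`.
    mellinInv, ← integral_neg_eq_self, integral_mul_const, mul_comm (∫ _, _) Complex.I, ← mul_assoc,
    mul_div_assoc, ← integral_div, Complex.real_smul]
  congr 1
  · push_cast
    field_simp
  · refine integral_congr_ae (.of_forall fun t => ?_)
    simp only
    set s : ℂ := c + t * Complex.I with hs
    have hsre : s.re = c := by simp [hs]
    have hs0 : s ≠ 0 := fun h => hc.ne' (by rw [← hsre, h, Complex.zero_re])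
    have hneg : ((-c : ℝ) : ℂ) + ((-t : ℝ) : ℂ) * Complex.I = -s := by
      rw [hs]
      push_cast
      ring
    rw [hneg, (mellin_cdf_gammaMeasure_mconv hm (s := -s) (by simpa [hsre] using hc)
      (by simpa [hsre] using hcm)).2, meijerGIntegrand_two_one, neg_neg, ← sub_eq_add_neg,
      add_comm 1 s, Complex.Gamma_add_one _ hs0, Complex.ofReal_mul,
      Complex.mul_cpow_ofReal_nonneg (by positivity) hz.le, smul_eq_mul, Complex.ofReal_pow,
      Complex.ofReal_pow, ← Complex.Gamma_ofReal, sq (m : ℂ),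
      Complex.mul_cpow_ofReal_nonneg hm.le hm.le]
    have hΓs : Complex.Gamma s ≠ 0 := Complex.Gamma_ne_zero_of_re_pos (hsre ▸ hc)
    field_simp

end GammaProduct

/-! ### The density and the distribution function of the product gain -/

theorem lemma2 {Ω : Type*} [MeasurableSpace Ω] (P : Measure Ω) [IsProbabilityMeasure P]
    (m : ℝ) (hm : 0 < m) (gd gu : Ω → ℝ)
    (hgd : HasLaw gd (gammaMeasure m m) P) (hgu : HasLaw gu (gammaMeasure m m) P)
    (hindep : IndepFun gd gu P) :
    (HasPDF (fun ω => gd ω * gu ω) P volume ∧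
      pdf (fun ω => gd ω * gu ω) P volume =ᵐ[volume] fun z : ℝ =>
        ENNReal.ofReal (if 0 < z then
          2 * m ^ (2 * m) / Real.Gamma m ^ 2 * z ^ (m - 1) * besselK 0 (2 * m * Real.sqrt z)
        else 0)) ∧
    (∀ z : ℝ, 0 < z →
      (cdf (P.map (fun ω => gd ω * gu ω)) z : ℂ) =
        meijerG 2 1 ![(1 : ℂ)] ![(m : ℂ), (m : ℂ), 0] ((m ^ 2 * z : ℝ) : ℂ) /
          ((Real.Gamma m ^ 2 : ℝ) : ℂ)) ∧
    (∀ z : ℝ, z ≤ 0 → cdf (P.map (fun ω => gd ω * gu ω)) z = 0) := by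
  have := isProbabilityMeasure_gammaMeasure hm hm
  have hlaw := hindep.hasLaw_fun_mul hgd hgu
  have hprob := hlaw.isProbabilityMeasure_iff.1 ‹_›
  obtain ⟨f, hf, hfK, hmconv⟩ := gammaMeasure_mconv_gammaMeasure hm
  have hmap := hlaw.map_eq.trans hmconv
  have hpdf := hasPDF_of_map_eq_withDensity hlaw.aemeasurable f hf.aemeasurable hmap
  refine ⟨⟨hpdf, ((pdf.eq_of_map_eq_withDensity f hf.aemeasurable).1 hmap).trans hfK⟩, ?_, ?_⟩
  · intro z hz
    have hatoms : NullSingletonClass ((gammaMeasure m m).mconv (gammaMeasure m m)) :=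
      ⟨fun x => hmconv ▸ withDensity_absolutelyContinuous volume f (measure_singleton x)⟩
    have hex : ∃ c : ℝ, MeijerGSeparates 2 1 ![(1 : ℂ)] ![(m : ℂ), (m : ℂ), 0] c :=
      ⟨m / 2, (meijerGSeparates_two_one_iff m _).2 ⟨by linarith, by linarith⟩⟩
    obtain ⟨hc, hcm⟩ := (meijerGSeparates_two_one_iff m _).1 hex.choose_spec
    rw [hlaw.map_eq, cdf_gammaMeasure_mconv hm hc hcm hz, meijerG, dif_pos hex]
  · intro z hz
    have hpos := mconv_ae_pos (gammaMeasure_ae_pos m m) (gammaMeasure_ae_pos m m)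
    rw [hlaw.map_eq, cdf_eq_real, measureReal_eq_zero_iff]
    exact measure_mono_null (fun x (hx : x ≤ z) => not_lt.2 (hx.trans hz)) hpos
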